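/- Let $k\ge 1$ be an integer. A set $\mathcal S$ of positive integers is called a $\mathcal D_k$ set if every equality $\sum_{s\in\mathcal S}\varepsilon_s s=0$ with $\varepsilon_s\in\{-k,\dots,-1,0,1,\dots,k\}$, all but finitely many $\varepsilon_s$ being $0$, implies that all the $\varepsilon_s$ are $0$. (1) If $\mathcal S=\{a_1<\cdots<a_m\}$, $m\ge 1$, is a $\mathcal D_k$ set, then $$a_m\ \ge\ (1+o(1))\,\frac{(k+1)^m}{2}\,\sqrt{\frac{6}{m\pi k(k+2)}},$$ where $o(1)$ denotes a function of $m$, depending only on $k$ and not on $\mathcal S$, that tends to $0$ as $m\to\infty$. (2) If $\mathcal S$ is an infinite $\mathcal D_k$ set and $\mathcal S(n):=\mathcal S\cap[1,n]$, then for all integers $n\ge 2$ $$|\mathcal S(n)|\ \le\ \log_{k+1}n+\tfrac12\log_{k+1}\log_2 n+\tfrac12\log_{k+1}\!\left(\frac{2\pi}{3}\,k(k+2)\right)+o(1),$$ where $o(1)$ denotes a function of $n$, depending only on $k$ and not on $\mathcal S$, that tends to $0$ as $n\to\infty$. -/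

import Mathlib

open Filter Topology

/-- A set `S` of positive integers is a `D_k` set if every relation `∑ ε_s s = 0` with integer
coefficients `ε_s ∈ {-k, …, k}`, `s ∈ S`, all but finitely many of them zero, is the trivial one.
(A sum of infinitely many nonzero integers does not converge, so for infinite `S` only finitely
supported `ε` can occur.) -/
def IsDkSet (k : ℕ) (S : Set ℕ) : Prop :=
  (∀ s ∈ S, 0 < s) ∧
    ∀ ε : ℕ →₀ ℤ, (ε.support : Set ℕ) ⊆ S →
      (∀ s, -(k : ℤ) ≤ ε s ∧ ε s ≤ (k : ℤ)) →
      ∑ s ∈ ε.support, ε s * (s : ℤ) = 0 → ε = 0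

/-!
The proof is the second moment method. Let `S` be a `D_k` set with `m` elements `a_i` and put
`N = (k + 1) ^ m`. The `N` sums `∑ f_i a_i` with `f_i ∈ {0, …, k}` are distinct integers: the
difference of two equal ones would be a forbidden relation (`IsDkSet.sum_injective`). On the one
hand, `N` distinct integers have variance at least that of an interval, `(N² - 1) / 12`
(`card_mul_sq_sub_one_le_sum_sq`). On the other hand, for independent uniform `f_i` the variance is
exactly `k (k + 2) / 12 * ∑ a_i²` (`sum_sq_sum_digit_mul`). Hence
`N² - 1 ≤ k (k + 2) ∑ a_i² ≤ k (k + 2) m a_m²` (`IsDkSet.pow_sq_sub_one_le`).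

The resulting constant is better than the one required: as `N ≥ 2`, we have
`N² - 1 ≥ 3 N² / 4`, while `3 N² / (2 π)` is all that is needed. The surplus makes the first
bound hold with error term `0`. In the second, it absorbs the passage from `log m` to
`log (log₂ n)`, for which the crude estimate `m ≤ (3 / 2) log₂ n` for `n ≥ 64` suffices,
since `3 / 2 < π / 2`.
-/

/-! ### The second moment of a set of integers -/

/-- Among all sets of `N` integers, an interval has the least second moment about its centre. The
inequality is proved by removing the two extreme elements, which are at least `N - 1` apart. -/
theorem card_mul_sq_sub_one_le_sum_sq (c : ℝ) (N : ℕ) (T : Finset ℤ) (hT : T.card = N) :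
    (N : ℝ) * ((N : ℝ) ^ 2 - 1) ≤ 12 * ∑ t ∈ T, ((t : ℝ) - c) ^ 2 := by
  induction N using Nat.strong_induction_on generalizing T with
  | _ N ih =>
    rcases Nat.lt_or_ge N 2 with hN | hN
    · have h0 : 0 ≤ ∑ t ∈ T, ((t : ℝ) - c) ^ 2 := Finset.sum_nonneg fun _ _ => sq_nonneg _
      interval_cases N <;> norm_num <;> exact h0
    · obtain ⟨n, rfl⟩ : ∃ n, N = n + 2 := ⟨N - 2, by omega⟩
      have hne : T.Nonempty := Finset.card_pos.mp (by omega)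
      set M := T.max' hne with hM
      set μ := T.min' hne with hμ
      have hsub : T ⊆ Finset.Icc μ M := fun t ht =>
        Finset.mem_Icc.mpr ⟨T.min'_le t ht, T.le_max' t ht⟩
      have hcard : (n : ℤ) + 1 ≤ M - μ := by
        have h := Finset.card_le_card hsub
        rw [hT, Int.card_Icc] at h
        omega
      have hμT : μ ∈ T.erase M :=
        Finset.mem_erase.mpr ⟨by omega, T.min'_mem hne⟩
      have hMT : M ∈ T := T.max'_mem hne
      have hc : ((T.erase M).erase μ).card = n := by
        rw [Finset.card_erase_of_mem hμT, Finset.card_erase_of_mem hMT, hT]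
        omega
      have hih := ih n (by omega) _ hc
      have hcard' : (n : ℝ) + 1 ≤ (M : ℝ) - μ := by exact_mod_cast hcard
      have hsq : ((n : ℝ) + 1) ^ 2 ≤ ((M : ℝ) - μ) ^ 2 :=
        pow_le_pow_left₀ (by positivity) hcard' 2
      rw [← Finset.add_sum_erase T _ hMT, ← Finset.add_sum_erase _ _ hμT]
      push_cast
      nlinarith [sq_nonneg ((M : ℝ) + μ - 2 * c)]

/-! ### The second moment of a random sum -/

theorem sum_two_mul_sub (k : ℕ) : ∑ x : Fin (k + 1), (2 * (x : ℝ) - k) = 0 := by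
  rw [Fin.sum_univ_eq_sum_range (fun x : ℕ => 2 * (x : ℝ) - k) (k + 1), Finset.sum_sub_distrib,
    ← Finset.mul_sum]
  have h (n : ℕ) : ∑ i ∈ Finset.range (n + 1), (i : ℝ) = n * (n + 1) / 2 := by
    induction n with
    | zero => simp
    | succ n ih => rw [Finset.sum_range_succ, ih]; push_cast; ring
  rw [h]
  simp
  ring

theorem sum_two_mul_sub_sq (k : ℕ) :
    ∑ x : Fin (k + 1), (2 * (x : ℝ) - k) ^ 2 = ((k : ℝ) + 1) * (k * (k + 2)) / 3 := by
  rw [Fin.sum_univ_eq_sum_range (fun x : ℕ => (2 * (x : ℝ) - k) ^ 2) (k + 1)]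
  have h (c : ℝ) (n : ℕ) : ∑ i ∈ Finset.range (n + 1), (2 * (i : ℝ) - c) ^ 2 =
      2 * ((n : ℝ) * (n + 1) * (2 * n + 1)) / 3 - 2 * c * (n * (n + 1)) + (n + 1) * c ^ 2 := by
    induction n with
    | zero => simp
    | succ n ih => rw [Finset.sum_range_succ, ih]; push_cast; ring
  rw [h]
  ring

theorem sum_pi_succ_eq {α M : Type*} [Fintype α] [AddCommMonoid M] {m : ℕ}
    (F : (Fin (m + 1) → α) → M) :
    ∑ f, F f = ∑ x : α, ∑ g : Fin m → α, F (Fin.cons x g) := by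
  rw [← Fintype.sum_prod_type']
  exact (Fintype.sum_equiv (Fin.consEquiv fun _ => α) _ _ fun _ => rfl).symm

theorem sum_sum_digit_mul (k m : ℕ) (a : Fin m → ℝ) :
    ∑ f : Fin m → Fin (k + 1), ∑ i, (2 * (f i : ℝ) - k) * a i = 0 := by
  induction m with
  | zero => simp
  | succ m ih =>
    rw [sum_pi_succ_eq]
    simp only [Fin.sum_univ_succ (n := m), Fin.cons_zero, Fin.cons_succ, Finset.sum_add_distrib,
      ih, Finset.sum_const, ← Finset.smul_sum, ← Finset.sum_mul, sum_two_mul_sub]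
    simp

/-- The variance of `∑ f_i a_i` for independent `f_i`, uniform on `{0, …, k}`, up to
normalisation: `f_i` is replaced by `2 f_i - k`, which has mean `0`. -/
theorem sum_sq_sum_digit_mul (k m : ℕ) (a : Fin m → ℝ) :
    ∑ f : Fin m → Fin (k + 1), (∑ i, (2 * (f i : ℝ) - k) * a i) ^ 2 =
      (k + 1) ^ m * (k * (k + 2)) / 3 * ∑ i, a i ^ 2 := by
  induction m with
  | zero => simp
  | succ m ih =>
    have hstep (x : Fin (k + 1)) :
        ∑ g : Fin m → Fin (k + 1),
            ((2 * (x : ℝ) - k) * a 0 + ∑ i : Fin m, (2 * (g i : ℝ) - k) * a i.succ) ^ 2 =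
          (2 * (x : ℝ) - k) ^ 2 * ((k + 1) ^ m * a 0 ^ 2) +
            (k + 1) ^ m * (k * (k + 2)) / 3 * ∑ i : Fin m, a i.succ ^ 2 := by
      simp only [add_sq, Finset.sum_add_distrib, ← Finset.mul_sum, ih,
        sum_sum_digit_mul k m fun i => a i.succ]
      simp
      ring
    rw [sum_pi_succ_eq]
    simp only [Fin.sum_univ_succ (n := m), Fin.cons_zero, Fin.cons_succ, hstep,
      Finset.sum_add_distrib, ← Finset.sum_mul, sum_two_mul_sub_sq]
    simp
    ring

/-! ### Cardinality and maximum of `D_k` sets -/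

theorem IsDkSet.mono {k : ℕ} {S T : Set ℕ} (hT : IsDkSet k T) (h : S ⊆ T) : IsDkSet k S :=
  ⟨fun s hs => hT.1 s (h hs), fun ε hε => hT.2 ε (hε.trans h)⟩

/-- The coefficients `f i - g i` of a difference of two such sums lie in `{-k, …, k}`. -/
theorem IsDkSet.sum_injective {k m : ℕ} {S : Set ℕ} (hS : IsDkSet k S) (a : Fin m ↪ ℕ)
    (ha : ∀ i, a i ∈ S) :
    Function.Injective fun f : Fin m → Fin (k + 1) => ∑ i, ((f i : ℕ) : ℤ) * (a i : ℤ) := by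
  intro f g hfg
  let d : Fin m →₀ ℤ := Finsupp.equivFunOnFinite.symm fun i => ((f i : ℕ) : ℤ) - ((g i : ℕ) : ℤ)
  have hd (i : Fin m) : d i = ((f i : ℕ) : ℤ) - ((g i : ℕ) : ℤ) := rfl
  have h0 : Finsupp.embDomain a d = 0 := by
    refine hS.2 _ ?_ ?_ ?_
    · intro s hs
      rw [Finsupp.support_embDomain] at hs
      obtain ⟨i, -, rfl⟩ := Finset.mem_map.mp (Finset.mem_coe.mp hs)
      exact ha i
    · intro s
      by_cases hs : s ∈ Set.range a
      · obtain ⟨i, rfl⟩ := hs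
        rw [Finsupp.embDomain_apply_self, hd]
        have := (f i).is_lt
        have := (g i).is_lt
        constructor <;> omega
      · rw [Finsupp.embDomain_of_notMem_range _ _ _ hs]
        constructor <;> omega
    · rw [Finsupp.support_embDomain, Finset.sum_map]
      simp only [Finsupp.embDomain_apply_self]
      rw [Finset.sum_subset (Finset.subset_univ _)]
      · simp only [hd, sub_mul, Finset.sum_sub_distrib]
        exact sub_eq_zero.mpr hfg
      · intro i _ hi
        rw [Finsupp.notMem_support_iff.mp hi, zero_mul]
  have hd0 : d = 0 := Finsupp.embDomain_eq_zero.mp h0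
  funext i
  have : d i = 0 := by rw [hd0]; rfl
  rw [hd] at this
  exact Fin.ext (by omega)

/-- Both estimates of the second moment, applied to the `(k + 1) ^ m` sums `∑ f_i a_i` about their
mean `(k / 2) ∑ a_i`. -/
theorem IsDkSet.pow_sq_sub_one_le {k n : ℕ} {S : Finset ℕ} (hS : IsDkSet k (S : Set ℕ))
    (hn : ∀ s ∈ S, s ≤ n) :
    (((k : ℝ) + 1) ^ S.card) ^ 2 - 1 ≤ k * (k + 2) * (S.card * (n : ℝ) ^ 2) := by
  set m := S.card with hm
  let a : Fin m ↪ ℕ := (S.orderEmbOfFin rfl).toEmbedding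
  have ha (i : Fin m) : a i ∈ S := S.orderEmbOfFin_mem rfl i
  have hinj := hS.sum_injective a ha
  set X : (Fin m → Fin (k + 1)) → ℤ := fun f => ∑ i, ((f i : ℕ) : ℤ) * (a i : ℤ) with hX
  have hcard : (Finset.univ.image X).card = (k + 1) ^ m := by
    rw [Finset.card_image_of_injective _ hinj]
    simp
  have hlow := card_mul_sq_sub_one_le_sum_sq ((k : ℝ) / 2 * ∑ i, (a i : ℝ)) _ _ hcard
  rw [Finset.sum_image fun _ _ _ _ h => hinj h] at hlow
  have hcentre (f : Fin m → Fin (k + 1)) :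
      ((X f : ℝ) - (k : ℝ) / 2 * ∑ i, (a i : ℝ)) ^ 2 =
        1 / 4 * (∑ i, (2 * (f i : ℝ) - k) * (a i : ℝ)) ^ 2 := by
    have : ∑ i, (2 * (f i : ℝ) - k) * (a i : ℝ) =
        2 * ((X f : ℝ) - (k : ℝ) / 2 * ∑ i, (a i : ℝ)) := by
      simp only [hX, sub_mul, Finset.sum_sub_distrib, mul_assoc, ← Finset.mul_sum]
      push_cast
      ring
    rw [this]
    ring
  simp only [hcentre, ← Finset.mul_sum] at hlow
  rw [sum_sq_sum_digit_mul k m fun i => (a i : ℝ)] at hlow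
  have hup : ∑ i, (a i : ℝ) ^ 2 ≤ m * (n : ℝ) ^ 2 := by
    calc ∑ i, (a i : ℝ) ^ 2 ≤ ∑ _i : Fin m, (n : ℝ) ^ 2 :=
          Finset.sum_le_sum fun i _ =>
            pow_le_pow_left₀ (by positivity) (by exact_mod_cast hn _ (ha i)) 2
      _ = m * (n : ℝ) ^ 2 := by simp
  have hN : (0 : ℝ) < ((k : ℝ) + 1) ^ m := by positivity
  push_cast at hlow
  have hlow' : (((k : ℝ) + 1) ^ m) ^ 2 - 1 ≤ k * (k + 2) * ∑ i, (a i : ℝ) ^ 2 := by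
    refine le_of_mul_le_mul_left ?_ hN
    linarith
  exact hlow'.trans (mul_le_mul_of_nonneg_left hup (by positivity))

theorem IsDkSet.three_mul_pow_sq_le {k n : ℕ} (hk : 1 ≤ k) {S : Finset ℕ} (hne : S.Nonempty)
    (hS : IsDkSet k (S : Set ℕ)) (hn : ∀ s ∈ S, s ≤ n) :
    3 * (((k : ℝ) + 1) ^ S.card) ^ 2 ≤ 4 * (k * (k + 2) * (S.card * (n : ℝ) ^ 2)) := by
  have h := hS.pow_sq_sub_one_le hn
  have hk' : (1 : ℝ) ≤ k := by exact_mod_cast hk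
  have hN : (2 : ℝ) ≤ ((k : ℝ) + 1) ^ S.card :=
    calc (2 : ℝ) ≤ (k : ℝ) + 1 := by linarith
      _ ≤ ((k : ℝ) + 1) ^ S.card := le_self_pow₀ (by linarith) hne.card_pos.ne'
  nlinarith

theorem IsDkSet.pow_div_two_mul_sqrt_le {k n : ℕ} (hk : 1 ≤ k) {S : Finset ℕ} (hne : S.Nonempty)
    (hS : IsDkSet k (S : Set ℕ)) (hn : ∀ s ∈ S, s ≤ n) :
    ((k : ℝ) + 1) ^ S.card / 2 * √(6 / ((S.card : ℝ) * Real.pi * (k : ℝ) * ((k : ℝ) + 2))) ≤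
      n := by
  have h := hS.three_mul_pow_sq_le hk hne hn
  have hk' : (0 : ℝ) < k := by exact_mod_cast hk
  have hm : (0 : ℝ) < S.card := by exact_mod_cast hne.card_pos
  have hpi := Real.pi_gt_three
  -- After squaring, the claim is `three_mul_pow_sq_le` with the constant `3 / 4` weakened
  -- to `3 / (2 π)`.
  refine (pow_le_pow_iff_left₀ (by positivity) (by positivity) two_ne_zero).mp ?_
  rw [mul_pow, Real.sq_sqrt (by positivity), mul_div_assoc', div_le_iff₀ (by positivity)]
  have hP : 0 ≤ (k : ℝ) * (k + 2) * (S.card * (n : ℝ) ^ 2) := by positivity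
  nlinarith

/-- A `D_k` set is a `D_1` set, so its cardinality is at most `(1 + o(1)) log₂ n`. The weak form
`m ≤ (3 / 2) log₂ n`, stated here without logarithms, is what the second bound needs. -/
theorem IsDkSet.four_pow_card_le {k n : ℕ} (hk : 1 ≤ k) (hn64 : 64 ≤ n) {S : Finset ℕ}
    (hS : IsDkSet k (S : Set ℕ)) (hn : ∀ s ∈ S, s ≤ n) : 4 ^ S.card ≤ n ^ 3 := by
  rcases Nat.lt_or_ge S.card 8 with hm | hm
  · calc 4 ^ S.card ≤ 4 ^ 9 := Nat.pow_le_pow_right (by norm_num) (by omega)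
      _ = 64 ^ 3 := by norm_num
      _ ≤ n ^ 3 := Nat.pow_le_pow_left hn64 3
  · have hS1 : IsDkSet 1 (S : Set ℕ) := by
      refine ⟨hS.1, fun ε hε hb => hS.2 ε hε fun s => ?_⟩
      have := hb s
      constructor <;> omega
    have hne : S.Nonempty := Finset.card_pos.mp (by omega)
    have h := hS1.three_mul_pow_sq_le le_rfl hne hn
    set m := S.card
    have h1 : 4 ^ m ≤ 4 * m * n ^ 2 := by
      have h2 : ((4 : ℝ)) ^ m ≤ 4 * m * (n : ℝ) ^ 2 := by
        have h3 : (((1 : ℕ) : ℝ) + 1) ^ m = (2 : ℝ) ^ m := by norm_num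
        rw [h3, ← pow_mul, mul_comm m 2, pow_mul] at h
        norm_num at h
        linarith
      exact_mod_cast h2
    have h2 : 64 * m ^ 3 ≤ 4 ^ m := by
      clear_value m
      clear h h1 hn
      induction m, hm using Nat.le_induction with
      | base => norm_num
      | succ m hm ih =>
        rw [pow_succ 4 m]
        nlinarith [Nat.mul_le_mul hm hm, Nat.mul_le_mul (Nat.mul_le_mul hm hm) hm,
          Nat.mul_le_mul_right (m ^ 2) hm, Nat.mul_le_mul_right m hm]
    have h3 : 4 ^ m * (4 ^ m) ^ 2 ≤ 4 ^ m * (n ^ 3) ^ 2 :=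
      calc 4 ^ m * (4 ^ m) ^ 2 = (4 ^ m) ^ 3 := by ring
        _ ≤ (4 * m * n ^ 2) ^ 3 := Nat.pow_le_pow_left h1 3
        _ = 64 * m ^ 3 * (n ^ 3) ^ 2 := by ring
        _ ≤ 4 ^ m * (n ^ 3) ^ 2 := Nat.mul_le_mul_right _ h2
    exact (Nat.pow_le_pow_iff_left two_ne_zero).mp
      (Nat.le_of_mul_le_mul_left h3 (by positivity))

theorem IsDkSet.card_le_logb {k n : ℕ} (hk : 1 ≤ k) (hn64 : 64 ≤ n) {S : Finset ℕ}
    (hS : IsDkSet k (S : Set ℕ)) (hn : ∀ s ∈ S, s ≤ n) (hne : S.Nonempty) :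
    (S.card : ℝ) ≤ Real.logb ((k : ℝ) + 1) (n : ℝ)
      + 1 / 2 * Real.logb ((k : ℝ) + 1) (Real.logb 2 (n : ℝ))
      + 1 / 2 * Real.logb ((k : ℝ) + 1) (2 * Real.pi / 3 * (k : ℝ) * ((k : ℝ) + 2)) := by
  have hk' : (0 : ℝ) < k := by exact_mod_cast hk
  have hb : 1 < (k : ℝ) + 1 := by linarith
  have hn0 : (0 : ℝ) < n := by exact_mod_cast (by omega : 0 < n)
  have hpi := Real.pi_gt_three
  have hm : (0 : ℝ) < S.card := by exact_mod_cast hne.card_pos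
  have hL : 2 * (S.card : ℝ) ≤ 3 * Real.logb 2 n := by
    have h : ((2 : ℝ) ^ (2 * S.card)) ≤ (n : ℝ) ^ 3 := by
      rw [pow_mul]
      norm_num
      exact_mod_cast hS.four_pow_card_le hk hn64 hn
    have h' := Real.logb_le_logb_of_le (b := 2) (by norm_num) (by positivity) h
    rw [Real.logb_pow, Real.logb_pow, Real.logb_self_eq_one (by norm_num)] at h'
    push_cast at h'
    linarith
  have hL0 : 0 < Real.logb 2 n := by linarith
  have h3 := hS.three_mul_pow_sq_le hk hne hn
  -- The constant `4 / 3` times `3 / 2` equals `2`, which is less than `2 π / 3`.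
  have hkey : (((k : ℝ) + 1) ^ S.card) ^ 2 ≤
      (n : ℝ) ^ 2 * Real.logb 2 n * (2 * Real.pi / 3 * k * (k + 2)) := by
    have hQ : 0 ≤ (k : ℝ) * (k + 2) * (n : ℝ) ^ 2 := by positivity
    have e1 := mul_le_mul_of_nonneg_left hL hQ
    have e2 := mul_le_mul_of_nonneg_right hpi.le (mul_nonneg hQ hL0.le)
    linarith
  have h' := Real.logb_le_logb_of_le hb (by positivity) hkey
  rw [Real.logb_mul (by positivity) (by positivity), Real.logb_mul (by positivity) hL0.ne',
    Real.logb_pow, Real.logb_pow, Real.logb_pow, Real.logb_self_eq_one hb] at h'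
  push_cast at h'
  linarith

theorem mainTheorem4 (k : ℕ) (hk : 1 ≤ k) :
    (∃ η : ℕ → ℝ, Tendsto η atTop (𝓝 0) ∧
      ∀ (S : Finset ℕ) (hS : S.Nonempty), IsDkSet k (S : Set ℕ) →
        (1 + η S.card) * (((k : ℝ) + 1) ^ S.card / 2) *
            √(6 / ((S.card : ℝ) * Real.pi * (k : ℝ) * ((k : ℝ) + 2)))
          ≤ ((S.max' hS : ℕ) : ℝ)) ∧
    (∃ θ : ℕ → ℝ, Tendsto θ atTop (𝓝 0) ∧
      ∀ S : Set ℕ, S.Infinite → IsDkSet k S →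
        ∀ n : ℕ, 2 ≤ n →
          ((S ∩ Set.Icc 1 n).ncard : ℝ) ≤
            Real.logb ((k : ℝ) + 1) (n : ℝ)
              + 1 / 2 * Real.logb ((k : ℝ) + 1) (Real.logb 2 (n : ℝ))
              + 1 / 2 * Real.logb ((k : ℝ) + 1) (2 * Real.pi / 3 * (k : ℝ) * ((k : ℝ) + 2))
              + θ n) := by
  refine ⟨⟨fun _ => 0, tendsto_const_nhds, fun S hne hS => ?_⟩, ?_⟩
  · rw [add_zero, one_mul]
    exact hS.pow_div_two_mul_sqrt_le hk hne fun s hs => S.le_max' s hs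
  · set B : ℕ → ℝ := fun n => Real.logb ((k : ℝ) + 1) (n : ℝ)
      + 1 / 2 * Real.logb ((k : ℝ) + 1) (Real.logb 2 (n : ℝ))
      + 1 / 2 * Real.logb ((k : ℝ) + 1) (2 * Real.pi / 3 * (k : ℝ) * ((k : ℝ) + 2)) with hB
    -- For `n ≥ 64` no error term is needed; below that the trivial bound `|S(n)| ≤ n` is used.
    refine ⟨fun n => if n < 64 then n - B n else 0, ?_, fun S hinf hS n hn => ?_⟩
    · refine tendsto_const_nhds.congr' ?_
      filter_upwards [eventually_ge_atTop 64] with n hn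
      rw [if_neg (by omega)]
    · change _ ≤ B n + if n < 64 then (n : ℝ) - B n else 0
      have hfin : (S ∩ Set.Icc 1 n).Finite := (Set.finite_Icc 1 n).inter_of_right S
      obtain ⟨T, hT⟩ := hfin.exists_finset_coe
      have hTn (s : ℕ) (hs : s ∈ T) : s ∈ S ∩ Set.Icc 1 n := hT ▸ Finset.mem_coe.mpr hs
      have hTD : IsDkSet k (T : Set ℕ) := hS.mono fun s hs => (hTn s hs).1
      rw [← hT, Set.ncard_coe_finset]
      by_cases h64 : n < 64
      · rw [if_pos h64]
        have hsub : T ⊆ Finset.Icc 1 n := fun s hs => Finset.mem_Icc.mpr (hTn s hs).2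
        have hle := Finset.card_le_card hsub
        rw [Nat.card_Icc, Nat.add_sub_cancel] at hle
        have : (T.card : ℝ) ≤ n := by exact_mod_cast hle
        linarith
      · rw [if_neg h64, add_zero]
        rcases T.eq_empty_or_nonempty with rfl | hne
        · have hk' : (1 : ℝ) ≤ k := by exact_mod_cast hk
          have hb : 1 < (k : ℝ) + 1 := by linarith
          have hn2 : (2 : ℝ) ≤ n := by exact_mod_cast hn
          have hpi := Real.pi_gt_three
          have h1 : 0 ≤ Real.logb ((k : ℝ) + 1) n := Real.logb_nonneg hb (by linarith)
          have h2 : 0 ≤ Real.logb ((k : ℝ) + 1) (Real.logb 2 n) := by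
            refine Real.logb_nonneg hb ?_
            rw [Real.le_logb_iff_rpow_le (by norm_num) (by linarith)]
            simpa using hn2
          have h3 : 0 ≤ Real.logb ((k : ℝ) + 1) (2 * Real.pi / 3 * k * (k + 2)) := by
            exact Real.logb_nonneg hb (one_le_mul_of_one_le_of_one_le
              (one_le_mul_of_one_le_of_one_le (by linarith) hk') (by linarith))
          simp only [hB, Finset.card_empty, Nat.cast_zero]
          positivity
        · exact hTD.card_le_logb hk (by omega) (fun s hs => (hTn s hs).2.2) hne
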